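/- Let $p\ge 1$, let $\|\cdot\|$ be the Euclidean norm of vectors and the spectral norm of matrices, $\mathbb B(x;r)$ the closed ball, $\mathrm{dist}$ the Euclidean distance and $\sigma_{\min}$ the smallest singular value. *Setting.* Let $\mathcal X\subseteq\mathbb R^n$ be closed and let $c:\mathbb R^n\to\mathbb R^p$ be locally Lipschitz and differentiable, with locally Lipschitz gradient $\nabla c(y)=[\nabla c_1(y),\dots,\nabla c_p(y)]\in\mathbb R^{n\times p}$. Put $\mathcal K=\mathcal X\cap\{c=0\}$. Let $\mathcal T_{\mathcal X}(y)$ be the Clarke tangent cone and $\mathcal N_{\mathcal X}(y)$ the limiting (Mordukhovich) normal cone of $\mathcal X$ at $y\in\mathcal X$, and $\mathrm{lin}(\mathcal C)=\mathcal C\cap(-\mathcal C)$. Let $Q:\mathcal X\to\mathbb R^{n\times n}$ be continuous, with symmetric positive semidefinite values, such that $\mathrm{null}(Q(y))=\mathrm{span}\,\mathcal N_{\mathcal X}(y)$ for all $y\in\mathcal X$, and let $\rho:\mathcal X\to[0,\infty)$ be bounded on compact sets with $$\mathrm{dist}(y+Q(y)d,\mathcal X)\le\rho(y)\|d\|^2\qquad\text{for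 all } y\in\mathcal X,\ \|d\|\le1.$$ Let $\tau:[0,\infty)\to[0,\infty)$ be locally Lipschitz and strictly increasing with $\tau(0)=0$, let $L_\tau>0$ be a constant with $\tau(t)\le L_\tau t$ for $0\le t\le 1$, and let $\xi:\mathbb R^n\to[0,\infty)$ be bounded on compact sets. For $y\in\mathcal X$ define $$\mathcal A(y)=y-Q(y)d(y),\qquad d(y)=\nabla c(y)\bigl(\nabla c(y)^\top Q(y)\nabla c(y)+\tau(\|c(y)\|)I_p\bigr)^{-1}c(y),$$ with $d(y)=0$ if $c(y)=0$, and let $\Pi_{\mathcal X}(z)=\arg\min_{y\in\mathcal X}\|z-y\|$. *Constants.* For $x\in\mathcal K$ let $\sigma_{x,Q}=\sigma_{\min}(\nabla c(x)^\top Q(x)\nabla c(x))$, $\sigma_{x,c}=\sigma_{\min}(\nabla c(x))$, and let $\gamma_x$ be the supremum of the $\gamma\in(0,1]$ such that $\sigma_{\min}(\nabla c(y)^\top Q(y)\nabla c(y))\ge\frac12\sigma_{x,Q}$ for all $y\in\mathcal X\cap\mathbb B(x;\gamma)$. Let $M_{x,c}$ and $M_{x,\xi}$ be the suprema of $\|\nabla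 c\|$ and $\xi$ over $\mathbb B(x;\gamma_x)$, let $M_{x,Q}$ and $L_{x,\rho}$ be the suprema of $\|Q\|$ and $\rho$ over $\mathcal X\cap\mathbb B(x;\gamma_x)$, and let $L_{x,c}=\sup\{\|\nabla c(y)-\nabla c(z)\|/\|y-z\| : y\ne z\in\mathbb B(x;\gamma_x)\}$. Put $$N_x=12L_{x,\rho}M_{x,c}^3+2L_\tau\sigma_{x,Q}+2L_{x,c}M_{x,Q}^2M_{x,c}^2+2\sigma_{x,Q}^2M_{x,c}M_{x,\xi},\qquad R_x=\frac{N_x}{\sigma_{x,Q}^2},$$ $$\delta_x=\min\Bigl\{\tfrac{\gamma_x}{2},\ \tfrac1{M_{x,c}},\ \tfrac{\sigma_{x,c}}{6L_{x,c}},\ \tfrac{\sigma_{x,Q}}{2M_{x,c}^2},\ \tfrac{\gamma_x\sigma_{x,Q}}{\sigma_{x,Q}+4M_{x,Q}M_{x,c}^2},\ \tfrac{M_{x,Q}\sigma_{x,Q}}{4L_{x,\rho}M_{x,c}^2+M_{x,\xi}\sigma_{x,Q}^2},\ \tfrac{\sigma_{x,Q}^2}{2M_{x,c}N_x}\Bigr\},$$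 $$\delta_x'=\frac{\sigma_{x,Q}}{32M_{x,Q}M_{x,c}^2+2\sigma_{x,Q}}\,\delta_x,\qquad \Omega_x=\mathcal X\cap\mathbb B(x;\delta_x),\qquad \Xi_x=\mathcal X\cap\mathbb B(x;\delta'_x),$$ where a quotient with denominator $0$ is read as $+\infty$ in the minimum. **Theorem.** Let $x\in\mathcal K$ satisfy the nondegeneracy condition $\nabla c(x)^\top\mathrm{lin}(\mathcal T_{\mathcal X}(x))=\mathbb R^p$. Then $\delta_x'>0$, and there is a constant $C>0$, independent of the sequence below, such that every sequence with $$x_0\in\Xi_x,\qquad x_{k+1}\in\Pi_{\mathcal X}(\mathcal A(x_k)+r_k),\qquad \|r_k\|\le\xi(x_k)\|c(x_k)\|^2\quad(k\ge0)$$ stays in $\Omega_x$ and converges quadratically to $\mathcal K\cap\Omega_x$: for all $k\ge 0$, $$\|c(x_{k+1})\|\le R_x\|c(x_k)\|^2,\qquad \mathrm{dist}(x_{k+1},\mathcal K)\le C\,\mathrm{dist}(x_k,\mathcal K)^2,$$ and there is $x_\infty\in\mathcal K\cap\Omega_x$ with $x_k\to x_\infty$ and $\|x_{k+1}-x_\infty\|\le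 C\|x_k-x_\infty\|^2$ for all $k\ge0$. -/

import Mathlib

open Set Filter Topology ContinuousLinearMap
open scoped NNReal

noncomputable section

/-- `ℝⁿ` with the Euclidean norm. -/
abbrev Vec (n : ℕ) : Type := EuclideanSpace ℝ (Fin n)

/-! ### Variational geometry -/

/-- The set `Π_X(z)` of nearest points of `X` to `z`. -/
def projSet {n : ℕ} (X : Set (Vec n)) (z : Vec n) : Set (Vec n) :=
  {y | y ∈ X ∧ ∀ w ∈ X, ‖z - y‖ ≤ ‖z - w‖}

/-- The Clarke tangent cone: the inner limit of `(X - x') / t` as `t ↓ 0` and `x' → x` in `X`. -/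
def clarkeTangentCone {n : ℕ} (X : Set (Vec n)) (x : Vec n) : Set (Vec n) :=
  {d | ∀ ε > 0, ∀ᶠ q : ℝ × Vec n in 𝓝[>] (0 : ℝ) ×ˢ 𝓝[X] x,
    ∃ y ∈ X, ‖q.1⁻¹ • (y - q.2) - d‖ < ε}

/-- The regular (Fréchet) normal cone: `⟨d, y - x⟩ ≤ o(‖y - x‖)` as `y → x` in `X`. -/
def regularNormalCone {n : ℕ} (X : Set (Vec n)) (x : Vec n) : Set (Vec n) :=
  {d | ∀ ε > 0, ∀ᶠ y in 𝓝[X] x, inner ℝ d (y - x) ≤ ε * ‖y - x‖}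

/-- The limiting (Mordukhovich) normal cone: the outer limit of the regular normal cones
at `y` as `y → x` in `X`. -/
def limitingNormalCone {n : ℕ} (X : Set (Vec n)) (x : Vec n) : Set (Vec n) :=
  {d | ∀ ε > 0, ∃ᶠ y in 𝓝[X] x, ∃ v ∈ regularNormalCone X y, ‖d - v‖ < ε}

/-- The lineality space `C ∩ (-C)` of a cone. -/
def linealitySpace {n : ℕ} (C : Set (Vec n)) : Set (Vec n) := {d | d ∈ C ∧ -d ∈ C}

/-! ### The problem data

Matrices are represented by continuous linear maps between Euclidean spaces, so that the
transpose is the adjoint and the norm is the spectral norm. Only the values of `Q` and `ρ`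
at points of `X` are ever used. -/

/-- The `n × p` matrix `∇c(y)` whose columns are the gradients of the components of `c`,
i.e. the transpose of the Jacobian. -/
def gradMap {n p : ℕ} (c : Vec n → Vec p) (y : Vec n) : Vec p →L[ℝ] Vec n :=
  adjoint (fderiv ℝ c y)

/-- Assumption on the sets `X` and `{c = 0}`. -/
structure SetAssumption {n p : ℕ} (X : Set (Vec n)) (c : Vec n → Vec p) : Prop where
  isClosed : IsClosed X
  locallyLipschitz : LocallyLipschitz c
  differentiable : Differentiable ℝ c
  gradLocallyLipschitz : LocallyLipschitz (gradMap c)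

/-- `Q` is a projective mapping for `X`, with function `ρ` in the distance estimate. -/
structure IsProjectiveMapping {n : ℕ} (X : Set (Vec n)) (Q : Vec n → Vec n →L[ℝ] Vec n)
    (ρ : Vec n → ℝ) : Prop where
  continuousOn : ContinuousOn Q X
  isPositive : ∀ x ∈ X, (Q x).IsPositive
  ker_eq : ∀ x ∈ X, LinearMap.ker (Q x : Vec n →ₗ[ℝ] Vec n) =
    Submodule.span ℝ (limitingNormalCone X x)
  rho_nonneg : ∀ x ∈ X, 0 ≤ ρ x
  rho_locallyBounded : ∀ S ⊆ X, IsCompact S → BddAbove (ρ '' S)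
  infDist_le : ∀ x ∈ X, ∀ d : Vec n, ‖d‖ ≤ 1 → Metric.infDist (x + Q x d) X ≤ ρ x * ‖d‖ ^ 2

/-- The regularization function `τ : [0, ∞) → [0, ∞)` with its constant `Lτ`. -/
structure IsRegularization (τ : ℝ≥0 → ℝ≥0) (Lτ : ℝ) : Prop where
  locallyLipschitz : LocallyLipschitz τ
  strictMono : StrictMono τ
  map_zero : τ 0 = 0
  const_pos : 0 < Lτ
  le_mul : ∀ t : ℝ≥0, t ≤ 1 → (τ t : ℝ) ≤ Lτ * t

/-- The inexactness function `ξ : ℝⁿ → [0, ∞)`: bounded on every compact set. -/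
structure IsInexactness {n : ℕ} (ξ : Vec n → ℝ) : Prop where
  nonneg : ∀ y, 0 ≤ ξ y
  locallyBounded : ∀ S, IsCompact S → BddAbove (ξ '' S)

/-- The feasible set `K = X ∩ {c = 0}`. -/
def feasibleSet {n p : ℕ} (X : Set (Vec n)) (c : Vec n → Vec p) : Set (Vec n) :=
  X ∩ {y | c y = 0}

/-- The nondegeneracy condition `∇c(x)ᵀ lin(T_X(x)) = ℝᵖ`. -/
def Nondegenerate {n p : ℕ} (X : Set (Vec n)) (c : Vec n → Vec p) (x : Vec n) : Prop :=
  adjoint (gradMap c x) '' linealitySpace (clarkeTangentCone X x) = univ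

/-- The `p × p` matrix `∇c(y)ᵀ Q(y) ∇c(y)`. -/
def gramMap {n p : ℕ} (c : Vec n → Vec p) (Q : Vec n → Vec n →L[ℝ] Vec n) (y : Vec n) :
    Vec p →L[ℝ] Vec p :=
  (adjoint (gradMap c y)).comp ((Q y).comp (gradMap c y))

/-- `d(y) = ∇c(y) (∇c(y)ᵀ Q(y) ∇c(y) + τ(‖c(y)‖) I)⁻¹ c(y)`. For `y ∈ X` the matrix is invertible
whenever `c(y) ≠ 0`; if `c(y) = 0` then `d(y) = 0`. -/
def newtonDir {n p : ℕ} (c : Vec n → Vec p) (Q : Vec n → Vec n →L[ℝ] Vec n) (τ : ℝ≥0 → ℝ≥0)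
    (y : Vec n) : Vec n :=
  gradMap c y (ContinuousLinearMap.inverse
    (gramMap c Q y + (τ ‖c y‖₊ : ℝ) • ContinuousLinearMap.id ℝ (Vec p)) (c y))

/-- The constraint dissolving mapping `A(y) = y - Q(y) d(y)`. -/
def dissolve {n p : ℕ} (c : Vec n → Vec p) (Q : Vec n → Vec n →L[ℝ] Vec n) (τ : ℝ≥0 → ℝ≥0)
    (y : Vec n) : Vec n :=
  y - Q y (newtonDir c Q τ y)

/-- `u` is generated by the inexact scheme `u_{k+1} ∈ Π_X(A(u_k) + r_k)` with errors
`‖r_k‖ ≤ ξ(u_k) ‖c(u_k)‖²`. -/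
def IsGenerated {n p : ℕ} (X : Set (Vec n)) (c : Vec n → Vec p) (Q : Vec n → Vec n →L[ℝ] Vec n)
    (τ : ℝ≥0 → ℝ≥0) (ξ : Vec n → ℝ) (u : ℕ → Vec n) : Prop :=
  ∃ r : ℕ → Vec n, (∀ k, ‖r k‖ ≤ ξ (u k) * ‖c (u k)‖ ^ 2) ∧
    ∀ k, u (k + 1) ∈ projSet X (dissolve c Q τ (u k) + r k)

/-! ### The constants attached to a point `x` -/

/-- The smallest singular value of a matrix with `p` columns (`p ≥ 1`). -/
def sigmaMin {p m : ℕ} (B : Vec p →L[ℝ] Vec m) : ℝ :=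
  (B : Vec p →ₗ[ℝ] Vec m).singularValues (p - 1)

/-- `σ_{x,c}`. -/
def sigmaC {n p : ℕ} (c : Vec n → Vec p) (x : Vec n) : ℝ := sigmaMin (gradMap c x)

/-- `σ_{x,Q}`. -/
def sigmaQ {n p : ℕ} (c : Vec n → Vec p) (Q : Vec n → Vec n →L[ℝ] Vec n) (x : Vec n) : ℝ :=
  sigmaMin (gramMap c Q x)

/-- `γ_x`: the supremum of the radii `γ ∈ (0, 1]` for which the smallest singular value of
`∇c(y)ᵀ Q(y) ∇c(y)` is at least `σ_{x,Q} / 2` for all `y` in `X ∩ B(x; γ)`. -/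
def gammaR {n p : ℕ} (X : Set (Vec n)) (c : Vec n → Vec p) (Q : Vec n → Vec n →L[ℝ] Vec n)
    (x : Vec n) : ℝ :=
  sSup {γ : ℝ | 0 < γ ∧ γ ≤ 1 ∧
    ∀ y ∈ X ∩ Metric.closedBall x γ, sigmaQ c Q x / 2 ≤ sigmaMin (gramMap c Q y)}

section Constants

variable {n p : ℕ} (X : Set (Vec n)) (c : Vec n → Vec p) (Q : Vec n → Vec n →L[ℝ] Vec n)
  (ρ ξ : Vec n → ℝ) (Lτ : ℝ) (x : Vec n)

/-- `M_{x,c}`. -/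
def constMc : ℝ := sSup ((fun y => ‖gradMap c y‖) '' Metric.closedBall x (gammaR X c Q x))

/-- `M_{x,Q}`. -/
def constMQ : ℝ := sSup ((fun y => ‖Q y‖) '' (X ∩ Metric.closedBall x (gammaR X c Q x)))

/-- `M_{x,ξ}`. -/
def constMxi : ℝ := sSup (ξ '' Metric.closedBall x (gammaR X c Q x))

/-- `L_{x,c}`. -/
def constLc : ℝ :=
  sSup {l : ℝ | ∃ y ∈ Metric.closedBall x (gammaR X c Q x),
    ∃ z ∈ Metric.closedBall x (gammaR X c Q x),
      y ≠ z ∧ l = ‖gradMap c y - gradMap c z‖ / ‖y - z‖}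

/-- `L_{x,ρ}`. -/
def constLrho : ℝ := sSup (ρ '' (X ∩ Metric.closedBall x (gammaR X c Q x)))

/-- The quotient `a / b`, read as `+∞` when `b = 0`. -/
def quotTop (a b : ℝ) : EReal := if b = 0 then ⊤ else ((a / b : ℝ) : EReal)

/-- `12 L_ρ M_c³ + 2 Lτ σ_Q + 2 L_c M_Q² M_c² + 2 σ_Q² M_c M_ξ`. -/
def rateNum : ℝ :=
  12 * constLrho X c Q ρ x * constMc X c Q x ^ 3
    + 2 * Lτ * sigmaQ c Q x
    + 2 * constLc X c Q x * constMQ X c Q x ^ 2 * constMc X c Q x ^ 2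
    + 2 * sigmaQ c Q x ^ 2 * constMc X c Q x * constMxi X c Q ξ x

/-- The rate constant `R_x`. -/
def rateConst : ℝ := rateNum X c Q ρ ξ Lτ x / sigmaQ c Q x ^ 2

/-- `δ_x`. The minimum is finite because its first entry is. -/
def deltaR : ℝ :=
  let γ := gammaR X c Q x
  let Mc := constMc X c Q x
  let MQ := constMQ X c Q x
  let σQ := sigmaQ c Q x
  let σc := sigmaC c x
  (((γ / 2 : ℝ) : EReal)
    ⊓ quotTop 1 Mc
    ⊓ quotTop σc (6 * constLc X c Q x)
    ⊓ quotTop σQ (2 * Mc ^ 2)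
    ⊓ quotTop (γ * σQ) (σQ + 4 * MQ * Mc ^ 2)
    ⊓ quotTop (MQ * σQ) (4 * constLrho X c Q ρ x * Mc ^ 2 + constMxi X c Q ξ x * σQ ^ 2)
    ⊓ quotTop (σQ ^ 2) (rateNum X c Q ρ ξ Lτ x * (2 * Mc))).toReal

/-- `Ω_x = X ∩ B(x; δ_x)`. -/
def omegaSet : Set (Vec n) := X ∩ Metric.closedBall x (deltaR X c Q ρ ξ Lτ x)

/-- `δ'_x`. -/
def deltaR' : ℝ :=
  sigmaQ c Q x / (32 * constMQ X c Q x * constMc X c Q x ^ 2 + 2 * sigmaQ c Q x)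
    * deltaR X c Q ρ ξ Lτ x

/-- `Ξ_x = X ∩ B(x; δ'_x)`. -/
def xiSet : Set (Vec n) := X ∩ Metric.closedBall x (deltaR' X c Q ρ ξ Lτ x)

end Constants

end

/-! Write G = ∇cᵀQ∇c. If G(x)v = 0, positivity of Q(x) puts ∇c(x)v into ker Q(x), the span of the
limiting normals. These are orthogonal to lin T_X(x), so v is orthogonal to ∇c(x)ᵀ lin T_X(x) = ℝᵖ
and vanishes (`eq_zero_of_gramMap_eq_zero`). By continuity G is uniformly invertible on X near x.

One iteration (`LocalBounds.step`) is then a regularized Newton step for c = 0. The linearization of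
c at A(y) equals τ(‖c(y)‖)h with ‖h‖ = O(‖c(y)‖), hence is O(‖c(y)‖²); so are the Taylor remainder,
the distance from A(y) to X and the error r. The step has length at most D‖c(y)‖ and leaves a
residual at most R‖c(y)‖².

Near x the residual therefore at least halves (`LocalBounds.converges`): step lengths sum
geometrically, the iterates stay near x, and ‖u_k - x_∞‖ ≤ 2D‖c(u_k)‖. Conversely ‖c(u_k)‖ is at
most M times the distance to x_∞ or to K, so the quadratic rate of the residual passes to both
distances. -/

section SmallestSingularValue

/-! ### Smallest singular value as the optimal lower bound of a linear map. -/

variable {p m : ℕ}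

theorem sigmaMin_nonneg (B : Vec p →L[ℝ] Vec m) : 0 ≤ sigmaMin B :=
  LinearMap.singularValues_nonneg _ _

/-- A linear map expands every vector at least by its smallest singular value. -/
theorem sigmaMin_mul_norm_le (hp : 1 ≤ p) (B : Vec p →L[ℝ] Vec m) (v : Vec p) :
    sigmaMin B * ‖v‖ ≤ ‖B v‖ := by
  set T : Vec p →ₗ[ℝ] Vec m := (B : Vec p →ₗ[ℝ] Vec m) with hT
  have hn : Module.finrank ℝ (Vec p) = p := by simp
  have hs := T.isSymmetric_adjoint_comp_self
  set b := hs.eigenvectorBasis hn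
  -- Eigenvalues are listed in decreasing order, so index p - 1 is the smallest.
  have hmin : ∀ i : Fin p, sigmaMin B ^ 2 ≤ hs.eigenvalues hn i := fun i => by
    rw [sigmaMin, ← hT, T.sq_singularValues_of_lt hn (show p - 1 < p by omega)]
    exact hs.eigenvalues_antitone hn (Fin.le_def.2 (by simp; omega))
  have hsq : ‖B v‖ ^ 2 = ∑ i, hs.eigenvalues hn i * inner ℝ (b i) v ^ 2 := by
    have h1 : ‖B v‖ ^ 2 = inner ℝ ((LinearMap.adjoint T ∘ₗ T) v) v := by
      rw [LinearMap.comp_apply, LinearMap.adjoint_inner_left, real_inner_self_eq_norm_sq]; rfl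
    rw [h1, ← b.sum_inner_mul_inner]
    refine Finset.sum_congr rfl fun i _ => ?_
    rw [hs, hs.apply_eigenvectorBasis, inner_smul_right, real_inner_comm]
    simp only [RCLike.ofReal_real_eq_id, id]
    ring
  refine le_of_sq_le_sq ?_ (norm_nonneg _)
  rw [mul_pow, hsq, ← b.sum_sq_norm_inner_right v, Finset.mul_sum]
  refine Finset.sum_le_sum fun i _ => ?_
  rw [Real.norm_eq_abs, sq_abs]
  exact mul_le_mul_of_nonneg_right (hmin i) (sq_nonneg _)

/-- Test the bound on the unit eigenvector of BᵀB for its last eigenvalue, where the expansion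
factor is exactly the smallest singular value. -/
theorem le_sigmaMin (hp : 1 ≤ p) (B : Vec p →L[ℝ] Vec m) {s : ℝ}
    (h : ∀ v, s * ‖v‖ ≤ ‖B v‖) : s ≤ sigmaMin B := by
  set T : Vec p →ₗ[ℝ] Vec m := (B : Vec p →ₗ[ℝ] Vec m) with hT
  have hn : Module.finrank ℝ (Vec p) = p := by simp
  have hs := T.isSymmetric_adjoint_comp_self
  set i : Fin p := ⟨p - 1, by omega⟩
  set b := hs.eigenvectorBasis hn
  have hb : ‖b i‖ = 1 := b.orthonormal.1 i
  have h1 : ‖B (b i)‖ ^ 2 = sigmaMin B ^ 2 := by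
    have : ‖B (b i)‖ ^ 2 = inner ℝ ((LinearMap.adjoint T ∘ₗ T) (b i)) (b i) := by
      rw [LinearMap.comp_apply, LinearMap.adjoint_inner_left, real_inner_self_eq_norm_sq]; rfl
    rw [this, hs.apply_eigenvectorBasis, inner_smul_left, real_inner_self_eq_norm_sq, hb,
      sigmaMin, ← hT, T.sq_singularValues_of_lt hn (show p - 1 < p by omega)]
    simp [i]
  have h2 := h (b i)
  rw [hb, mul_one] at h2
  exact h2.trans (le_of_sq_le_sq h1.le (sigmaMin_nonneg B))

theorem sigmaMin_pos (hp : 1 ≤ p) (B : Vec p →L[ℝ] Vec m) (h : ∀ v, B v = 0 → v = 0) :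
    0 < sigmaMin B := by
  have hinj : Function.Injective (B : Vec p →ₗ[ℝ] Vec m) :=
    LinearMap.ker_eq_bot.1 (LinearMap.ker_eq_bot'.2 h)
  exact (LinearMap.injective_iff_forall_lt_finrank_singularValues_pos _).1 hinj _
    (by simp; omega)

end SmallestSingularValue

/-! ### Polarity between tangents and normals. -/

section Cones

variable {n : ℕ} {X : Set (Vec n)} {x : Vec n}

/-- A Clarke tangent is approximated by difference quotients of X at all nearby base points, and a
regular normal at such a point is nonpositive on them to first order. This uniformity lets the sign
survive the limit defining limiting normals. -/
theorem inner_nonpos_of_mem_clarkeTangentCone {w d : Vec n} (hw : w ∈ clarkeTangentCone X x)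
    (hd : d ∈ limitingNormalCone X x) : inner ℝ d w ≤ 0 := by
  -- regular normals at nearby points almost have the right sign
  have key : ∀ ε > 0, ∀ᶠ y in 𝓝[X] x, ∀ v ∈ regularNormalCone X y,
      inner ℝ v w ≤ ‖v‖ * ε := by
    intro ε hε
    obtain ⟨A, hA, B, hB, hAB⟩ := Filter.eventually_prod_iff.1 (hw ε hε)
    filter_upwards [hB] with y hy v hv
    refine le_of_forall_pos_le_add fun η hη => ?_
    -- Scaled so that the regular normal inequality loses at most tη over a displacement of length
    -- t(‖w‖ + ε).
    set η' := η / (‖w‖ + ε) with hη'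
    have hpos : 0 < ‖w‖ + ε := by positivity
    have hη'pos : 0 < η' := by positivity
    obtain ⟨r, hr, hball⟩ := Metric.mem_nhdsWithin_iff.1 (hv η' hη'pos)
    have hsmall : ∀ᶠ t in 𝓝[>] (0 : ℝ), t * (‖w‖ + ε) < r := by
      refine Filter.Eventually.filter_mono nhdsWithin_le_nhds ?_
      have : Tendsto (fun t : ℝ => t * (‖w‖ + ε)) (𝓝 0) (𝓝 (0 * (‖w‖ + ε))) :=
        (continuous_id.mul continuous_const).tendsto 0
      rw [zero_mul] at this
      exact this.eventually_lt_const hr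
    obtain ⟨t, ht, htr, ht0⟩ := (hA.and (hsmall.and self_mem_nhdsWithin)).exists
    have ht0 : 0 < t := ht0
    obtain ⟨z, hzX, hz⟩ := hAB ht hy
    simp only at hz
    set e := t⁻¹ • (z - y) - w with he
    have hzy : z - y = t • (w + e) := by
      rw [he, add_sub_cancel, smul_smul, mul_inv_cancel₀ ht0.ne', one_smul]
    have hwe : ‖w + e‖ ≤ ‖w‖ + ε := (norm_add_le _ _).trans (by linarith)
    have hnorm : ‖z - y‖ ≤ t * (‖w‖ + ε) := by
      rw [hzy, norm_smul, Real.norm_of_nonneg ht0.le]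
      exact mul_le_mul_of_nonneg_left hwe ht0.le
    have hin : inner ℝ v (z - y) ≤ η' * ‖z - y‖ :=
      hball ⟨by rw [mem_ball_iff_norm]; exact hnorm.trans_lt htr, hzX⟩
    have h1 : t * inner ℝ v (w + e) ≤ t * η := by
      calc t * inner ℝ v (w + e) = inner ℝ v (z - y) := by rw [hzy, inner_smul_right]
        _ ≤ η' * (t * (‖w‖ + ε)) := hin.trans (mul_le_mul_of_nonneg_left hnorm hη'pos.le)
        _ = t * η := by rw [hη']; field_simp
    have h2 := le_of_mul_le_mul_left h1 ht0
    rw [inner_add_right] at h2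
    have h3 : -(‖v‖ * ε) ≤ inner ℝ v e := by
      have := neg_le_of_abs_le (abs_real_inner_le_norm v e)
      have h4 : ‖v‖ * ‖e‖ ≤ ‖v‖ * ε := mul_le_mul_of_nonneg_left hz.le (norm_nonneg _)
      linarith
    linarith
  refine le_of_forall_pos_le_add fun η hη => ?_
  -- Replacing d by v costs ε‖w‖, and v itself contributes at most ε(‖d‖ + 1); D collects both.
  set D := ‖d‖ + 1 + ‖w‖ with hD
  have hDpos : 0 < D := by positivity
  set ε := min 1 (η / D) with hε
  have hεpos : 0 < ε := lt_min one_pos (by positivity)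
  obtain ⟨y, ⟨v, hv, hdv⟩, hy⟩ := ((hd ε hεpos).and_eventually (key ε hεpos)).exists
  have h1 := hy v hv
  have h2 : inner ℝ (d - v) w ≤ ε * ‖w‖ :=
    (real_inner_le_norm _ _).trans (mul_le_mul_of_nonneg_right hdv.le (norm_nonneg _))
  have h3 : ‖v‖ ≤ ‖d‖ + 1 := by
    have : ‖v‖ ≤ ‖d‖ + ‖d - v‖ := norm_le_norm_add_norm_sub _ _
    linarith [min_le_left 1 (η / D)]
  have h4 : ε * D ≤ η := by
    have := mul_le_mul_of_nonneg_right (min_le_right 1 (η / D)) hDpos.le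
    rwa [div_mul_cancel₀ _ hDpos.ne'] at this
  rw [inner_sub_left] at h2
  have h5 : ‖v‖ * ε ≤ (‖d‖ + 1) * ε := mul_le_mul_of_nonneg_right h3 hεpos.le
  rw [zero_add]
  calc inner ℝ d w ≤ ε * D := by rw [hD]; linarith
    _ ≤ η := h4

theorem inner_eq_zero_of_mem_linealitySpace {w d : Vec n}
    (hw : w ∈ linealitySpace (clarkeTangentCone X x))
    (hd : d ∈ Submodule.span ℝ (limitingNormalCone X x)) : inner ℝ d w = 0 := by
  induction hd using Submodule.span_induction with
  | mem d hd =>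
    have h1 := inner_nonpos_of_mem_clarkeTangentCone hw.1 hd
    have h2 := inner_nonpos_of_mem_clarkeTangentCone hw.2 hd
    rw [inner_neg_right] at h2
    linarith
  | zero => exact inner_zero_left _
  | add a b _ _ ha hb => rw [inner_add_left, ha, hb, add_zero]
  | smul r a _ ha => rw [inner_smul_left, ha, mul_zero]

end Cones

/-- Along v + t·Tv the quadratic form is 2t‖Tv‖² + t²a; being nonnegative for all t, it can have no
linear term. -/
theorem ContinuousLinearMap.IsPositive.apply_eq_zero_of_inner_eq_zero {E : Type*}
    [NormedAddCommGroup E] [InnerProductSpace ℝ E] [CompleteSpace E] {T : E →L[ℝ] E}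
    (hT : T.IsPositive) {v : E} (hv : inner ℝ (T v) v = 0) : T v = 0 := by
  have hpos : ∀ u, 0 ≤ inner ℝ (T u) u := fun u => hT.inner_nonneg_left u
  have hsymm : inner ℝ (T (T v)) v = ‖T v‖ ^ 2 := by
    have := hT.isSymmetric (T v) v
    simp only [ContinuousLinearMap.coe_coe] at this
    rw [this, real_inner_self_eq_norm_sq]
  set a := inner ℝ (T (T v)) (T v) with ha
  have hquad : ∀ t : ℝ, 0 ≤ 2 * t * ‖T v‖ ^ 2 + t ^ 2 * a := fun t => by
    have := hpos (v + t • T v)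
    simp only [map_add, map_smul, inner_add_left, inner_add_right, inner_smul_left,
      inner_smul_right, hv, hsymm, ← ha, real_inner_self_eq_norm_sq, RCLike.conj_to_real] at this
    linarith
  have ha0 : 0 ≤ a := hpos _
  have h1 : (0 : ℝ) < a + 1 := by linarith
  -- Dividing by a + 1 instead of a also covers a = 0.
  have hs := hquad (-(‖T v‖ ^ 2 / (a + 1)))
  have h3 : ‖T v‖ ^ 2 = 0 := by
    set q := ‖T v‖ ^ 2
    have e : 2 * -(q / (a + 1)) * q + (-(q / (a + 1))) ^ 2 * a
        = -(q ^ 2 * (a + 2)) / (a + 1) ^ 2 := by field_simp; ring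
    rw [e, neg_div, neg_nonneg, div_le_iff₀ (by positivity), zero_mul] at hs
    nlinarith [sq_nonneg q]
  simpa using h3

/-! ### Taylor and mean value estimates for c. -/

section Taylor

variable {n p : ℕ} {c : Vec n → Vec p}

theorem adjoint_gradMap (y : Vec n) : adjoint (gradMap c y) = fderiv ℝ c y :=
  adjoint_adjoint _

theorem norm_fderiv_sub_eq (y z : Vec n) :
    ‖fderiv ℝ c y - fderiv ℝ c z‖ = ‖gradMap c y - gradMap c z‖ := by
  rw [gradMap, gradMap, ← map_sub, LinearIsometryEquiv.norm_map]

theorem norm_fderiv_eq (y : Vec n) : ‖fderiv ℝ c y‖ = ‖gradMap c y‖ := by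
  rw [gradMap, LinearIsometryEquiv.norm_map]

/-- First order Taylor expansion with a remainder controlled by the Lipschitz constant of the
derivative. -/
theorem norm_sub_sub_fderiv_le {S : Set (Vec n)} (hS : Convex ℝ S) (hc : Differentiable ℝ c)
    {L : ℝ} (hL : ∀ y ∈ S, ∀ z ∈ S, ‖gradMap c y - gradMap c z‖ ≤ L * ‖y - z‖)
    {y z : Vec n} (hy : y ∈ S) (hz : z ∈ S) :
    ‖c z - c y - fderiv ℝ c y (z - y)‖ ≤ L / 2 * ‖z - y‖ ^ 2 := by
  set v := z - y with hv
  have hline : ∀ t : ℝ, HasDerivAt (fun t : ℝ => y + t • v) v t := fun t => by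
    simpa using ((hasDerivAt_id t).smul_const v).const_add y
  have hder : ∀ t : ℝ, HasDerivAt (fun t : ℝ => c (y + t • v) - c y - t • fderiv ℝ c y v)
      (fderiv ℝ c (y + t • v) v - fderiv ℝ c y v) t := fun t => by
    have h1 := (hc (y + t • v)).hasFDerivAt.comp_hasDerivAt t (hline t)
    have h2 := (hasDerivAt_id t).smul_const (fderiv ℝ c y v)
    simpa using (h1.sub_const (c y)).fun_sub h2
  have hB : ∀ t : ℝ, HasDerivAt (fun t : ℝ => L / 2 * ‖v‖ ^ 2 * t ^ 2) (L * ‖v‖ ^ 2 * t) t :=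
    fun t => by
      have := (hasDerivAt_pow 2 t).const_mul (L / 2 * ‖v‖ ^ 2)
      convert! this using 1
      simp; ring
  -- The remainder along the segment has derivative of norm at most L‖v‖²t; comparison with
  -- L/2·‖v‖²t² is read off at t = 1.
  have h := image_norm_le_of_norm_deriv_right_le_deriv_boundary (a := 0) (b := 1)
    (fun t _ => (hder t).continuousAt.continuousWithinAt)
    (fun t _ => (hder t).hasDerivWithinAt) (by simp) hB (fun t ht => by
      have hmem : y + t • v ∈ S := hS.add_smul_sub_mem hy hz ⟨ht.1, ht.2.le⟩
      rw [← _root_.sub_apply]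
      refine (le_opNorm _ _).trans ?_
      rw [norm_fderiv_sub_eq]
      have h1 := hL _ hmem y hy
      rw [add_sub_cancel_left, norm_smul, Real.norm_of_nonneg ht.1] at h1
      calc _ ≤ L * (t * ‖v‖) * ‖v‖ := mul_le_mul_of_nonneg_right h1 (norm_nonneg _)
        _ = _ := by ring) (right_mem_Icc.2 zero_le_one)
  simpa [hv] using h

theorem norm_sub_le_of_gradMap_le {S : Set (Vec n)} (hS : Convex ℝ S) (hc : Differentiable ℝ c)
    {M : ℝ} (hM : ∀ y ∈ S, ‖gradMap c y‖ ≤ M) {y z : Vec n} (hy : y ∈ S) (hz : z ∈ S) :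
    ‖c z - c y‖ ≤ M * ‖z - y‖ :=
  hS.norm_image_sub_le_of_norm_fderiv_le (fun w _ => hc w)
    (fun w hw => (norm_fderiv_eq w).trans_le (hM w hw)) hy hz

end Taylor

/-! ### Invertibility of the Gram matrix and its regularization. -/

section Gram

variable {n p : ℕ} {X : Set (Vec n)} {c : Vec n → Vec p} {Q : Vec n → Vec n →L[ℝ] Vec n}

theorem gramMap_isPositive {y : Vec n} (hQ : (Q y).IsPositive) : (gramMap c Q y).IsPositive :=
  hQ.adjoint_conj _

theorem gramMap_apply (y : Vec n) (v : Vec p) :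
    gramMap c Q y v = fderiv ℝ c y (Q y (gradMap c y v)) := by
  rw [gramMap, adjoint_gradMap]; rfl

theorem eq_zero_of_gramMap_eq_zero {ρ : Vec n → ℝ} (hQ : IsProjectiveMapping X Q ρ) {x : Vec n}
    (hx : x ∈ X) (hnd : Nondegenerate X c x) {v : Vec p} (hv : gramMap c Q x v = 0) : v = 0 := by
  have h1 : Q x (gradMap c x v) = 0 := by
    refine (hQ.isPositive x hx).apply_eq_zero_of_inner_eq_zero ?_
    have : inner ℝ (gramMap c Q x v) v = 0 := by rw [hv, inner_zero_left]
    rwa [gramMap, comp_apply, adjoint_inner_left] at this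
  have h2 : gradMap c x v ∈ Submodule.span ℝ (limitingNormalCone X x) := by
    rw [← hQ.ker_eq x hx]; exact h1
  obtain ⟨w, hw, hwv⟩ : v ∈ adjoint (gradMap c x) '' linealitySpace (clarkeTangentCone X x) := by
    rw [hnd]; exact mem_univ v
  have h3 := inner_eq_zero_of_mem_linealitySpace hw h2
  rw [← adjoint_inner_right, hwv, inner_self_eq_zero] at h3
  exact h3

theorem gramMap_continuousOn (hg : Continuous (gradMap c)) (hQ : ContinuousOn Q X) :
    ContinuousOn (gramMap c Q) X := by
  have h : Continuous fun y => adjoint (gradMap c y) :=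
    (LinearIsometryEquiv.continuous _).comp hg
  exact h.continuousOn.clm_comp (hQ.clm_comp hg.continuousOn)

/-- Adding a nonnegative multiple of the identity to a positive map does not shrink images. -/
theorem norm_apply_le_norm_add_smul {E : Type*} [NormedAddCommGroup E] [InnerProductSpace ℝ E]
    [CompleteSpace E] {G : E →L[ℝ] E} (hG : G.IsPositive) {t : ℝ} (ht : 0 ≤ t) (v : E) :
    ‖G v‖ ≤ ‖(G + t • ContinuousLinearMap.id ℝ E) v‖ := by
  refine le_of_sq_le_sq ?_ (norm_nonneg _)
  have h := mul_nonneg ht (hG.inner_nonneg_left v)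
  simp only [add_apply, smul_apply, id_apply, norm_add_sq_real, inner_smul_right]
  have h2 : 0 ≤ ‖t • v‖ ^ 2 := sq_nonneg _
  linarith

/-- The lower bound gives injectivity, hence bijectivity in finite dimension, so
`ContinuousLinearMap.inverse` is not its default value 0. -/
theorem apply_inverse_of_lower_bound {G : Vec p →L[ℝ] Vec p} {s : ℝ} (hs : 0 < s)
    (hG : ∀ v, s * ‖v‖ ≤ ‖G v‖) (b : Vec p) : G (ContinuousLinearMap.inverse G b) = b := by
  have hinj : Function.Injective (G : Vec p →ₗ[ℝ] Vec p) := by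
    refine LinearMap.ker_eq_bot.1 (LinearMap.ker_eq_bot'.2 fun v hv => ?_)
    have hv : G v = 0 := hv
    have := hG v
    rw [hv, norm_zero] at this
    exact norm_le_zero_iff.1 (nonpos_of_mul_nonpos_right this hs)
  set e := (LinearEquiv.ofInjectiveEndo _ hinj).toContinuousLinearEquiv
  have he : G = (e : Vec p →L[ℝ] Vec p) := by ext v; rfl
  rw [he, inverse_equiv]
  simp

end Gram

/-! ### Single-step estimates and convergence under abstract bounds. -/

/-- Bounds on the problem data near `x` that drive the convergence analysis. -/
structure LocalBounds {n p : ℕ} (X : Set (Vec n)) (c : Vec n → Vec p)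
    (Q : Vec n → Vec n →L[ℝ] Vec n) (ρ ξ : Vec n → ℝ) (Lτ : ℝ) (x : Vec n)
    (γ M MQ L Lρ Mξ σ δ : ℝ) : Prop where
  σ_pos : 0 < σ
  M_pos : 0 < M
  MQ_pos : 0 < MQ
  L_nonneg : 0 ≤ L
  Lρ_nonneg : 0 ≤ Lρ
  Mξ_nonneg : 0 ≤ Mξ
  δ_pos : 0 < δ
  grad_le : ∀ y ∈ Metric.closedBall x γ, ‖gradMap c y‖ ≤ M
  grad_lipschitz : ∀ y ∈ Metric.closedBall x γ, ∀ z ∈ Metric.closedBall x γ,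
    ‖gradMap c y - gradMap c z‖ ≤ L * ‖y - z‖
  Q_le : ∀ y ∈ X ∩ Metric.closedBall x γ, ‖Q y‖ ≤ MQ
  ρ_le : ∀ y ∈ X ∩ Metric.closedBall x γ, ρ y ≤ Lρ
  ξ_le : ∀ y ∈ Metric.closedBall x γ, ξ y ≤ Mξ
  gram_ge : ∀ y ∈ X ∩ Metric.closedBall x δ, ∀ v, σ / 2 * ‖v‖ ≤ ‖gramMap c Q y v‖
  δ_le_half : δ ≤ γ / 2
  δ_mul_M : δ * M ≤ 1
  δ_mul_sq : δ * (2 * M ^ 2) ≤ σ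
  δ_mul_radius : δ * (σ + 4 * MQ * M ^ 2) ≤ γ * σ
  δ_mul_error : δ * (4 * Lρ * M ^ 2 + Mξ * σ ^ 2) ≤ MQ * σ
  δ_mul_rate : δ * ((12 * Lρ * M ^ 3 + 2 * Lτ * σ + 2 * L * MQ ^ 2 * M ^ 2
    + 2 * σ ^ 2 * M * Mξ) * (2 * M)) ≤ σ ^ 2

namespace LocalBounds

variable {n p : ℕ} {X : Set (Vec n)} {c : Vec n → Vec p} {Q : Vec n → Vec n →L[ℝ] Vec n}
  {ρ ξ : Vec n → ℝ} {τ : ℝ≥0 → ℝ≥0} {Lτ : ℝ} {x : Vec n} {γ M MQ L Lρ Mξ σ δ : ℝ}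

theorem norm_le (B : LocalBounds X c Q ρ ξ Lτ x γ M MQ L Lρ Mξ σ δ) (hc : Differentiable ℝ c)
    {y z : Vec n} (hy : y ∈ Metric.closedBall x γ) (hz : z ∈ Metric.closedBall x γ)
    (hz0 : c z = 0) : ‖c y‖ ≤ M * ‖y - z‖ := by
  have := norm_sub_le_of_gradMap_le (convex_closedBall x γ) hc B.grad_le hz hy
  rwa [hz0, sub_zero] at this

theorem γ_pos (B : LocalBounds X c Q ρ ξ Lτ x γ M MQ L Lρ Mξ σ δ) : 0 < γ := by
  linarith [B.δ_pos, B.δ_le_half]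

theorem δ_le (B : LocalBounds X c Q ρ ξ Lτ x γ M MQ L Lρ Mξ σ δ) : δ ≤ γ := by
  linarith [B.δ_pos, B.δ_le_half]

/-- The estimates for one inexact step from a point of `X` near `x`. -/
theorem step (B : LocalBounds X c Q ρ ξ Lτ x γ M MQ L Lρ Mξ σ δ) (hX : SetAssumption X c)
    (hQ : IsProjectiveMapping X Q ρ) (hτ : IsRegularization τ Lτ) (hcx : c x = 0)
    {y r z : Vec n} (hy : y ∈ X ∩ Metric.closedBall x δ) (hr : ‖r‖ ≤ ξ y * ‖c y‖ ^ 2)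
    (hz : z ∈ projSet X (dissolve c Q τ y + r)) :
    ‖z - y‖ ≤ 4 * MQ * M / σ * ‖c y‖ ∧
    ‖c z‖ ≤ (12 * Lρ * M ^ 3 + 2 * Lτ * σ + 2 * L * MQ ^ 2 * M ^ 2 + 2 * σ ^ 2 * M * Mξ) / σ ^ 2
      * ‖c y‖ ^ 2 := by
  have hσ := B.σ_pos
  have hM := B.M_pos
  have hMQ := B.MQ_pos
  have hL := B.L_nonneg
  have hLρ := B.Lρ_nonneg
  have hMξ := B.Mξ_nonneg
  have hyX := hy.1
  have hyγ : y ∈ Metric.closedBall x γ := Metric.closedBall_subset_closedBall B.δ_le hy.2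
  have hxγ : x ∈ Metric.closedBall x γ := Metric.mem_closedBall_self B.γ_pos.le
  have hyδ : ‖y - x‖ ≤ δ := mem_closedBall_iff_norm.1 hy.2
  have hcM := B.norm_le hX.differentiable hyγ hxγ hcx
  set a := ‖c y‖ with ha
  have ha0 : 0 ≤ a := norm_nonneg _
  have haδ : a ≤ M * δ := hcM.trans (mul_le_mul_of_nonneg_left hyδ hM.le)
  have ha1 : a ≤ 1 := by linarith [B.δ_mul_M]
  -- the solution of the regularized system
  set t : ℝ := (τ ‖c y‖₊ : ℝ) with ht
  have ht0 : 0 ≤ t := NNReal.coe_nonneg _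
  have hta : t ≤ Lτ * a := hτ.le_mul ‖c y‖₊ (by exact_mod_cast ha1)
  have hpos := gramMap_isPositive (c := c) (hQ.isPositive y hyX)
  set G := gramMap c Q y + t • ContinuousLinearMap.id ℝ (Vec p) with hG
  have hGge : ∀ v, σ / 2 * ‖v‖ ≤ ‖G v‖ := fun v =>
    (B.gram_ge y hy v).trans (norm_apply_le_norm_add_smul hpos ht0 v)
  set h := ContinuousLinearMap.inverse G (c y) with hh
  have hGh : G h = c y := apply_inverse_of_lower_bound (by positivity) hGge _
  have hnh : ‖h‖ ≤ 2 / σ * a := by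
    have := hGge h
    rw [hGh] at this
    rw [div_mul_eq_mul_div, le_div_iff₀ hσ]
    linarith
  set d := newtonDir c Q τ y with hd
  have hdh : d = gradMap c y h := rfl
  have hnd : ‖d‖ ≤ 2 * M / σ * a := by
    rw [hdh]
    calc ‖gradMap c y h‖ ≤ ‖gradMap c y‖ * ‖h‖ := le_opNorm _ _
      _ ≤ M * (2 / σ * a) := by
        gcongr
        exact B.grad_le y hyγ
      _ = 2 * M / σ * a := by ring
  -- The distance estimate for y + Q(y)d is available only for directions in the unit ball.
  have hnd1 : ‖d‖ ≤ 1 := by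
    refine hnd.trans ?_
    rw [div_mul_eq_mul_div, div_le_one hσ]
    nlinarith [B.δ_mul_sq]
  have hQd : ‖Q y d‖ ≤ 2 * MQ * M / σ * a := by
    calc ‖Q y d‖ ≤ ‖Q y‖ * ‖d‖ := le_opNorm _ _
      _ ≤ MQ * (2 * M / σ * a) := by
        gcongr
        exact B.Q_le y ⟨hyX, hyγ⟩
      _ = _ := by ring
  set w := dissolve c Q τ y with hw
  have hwy : w - y = -Q y d := by rw [hw, dissolve]; abel
  -- the projection moves the dissolved point by a quadratically small amount
  have hinf : Metric.infDist w X ≤ Lρ * (2 * M / σ * a) ^ 2 := by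
    have h1 := hQ.infDist_le y hyX (-d) (by rwa [norm_neg])
    rw [map_neg, norm_neg, ← hwy, add_sub_cancel] at h1
    refine h1.trans ?_
    gcongr
    exact B.ρ_le y ⟨hyX, hyγ⟩
  have hr' : ‖r‖ ≤ Mξ * a ^ 2 := hr.trans (by gcongr; exact B.ξ_le y hyγ)
  have hproj : ‖w + r - z‖ ≤ Metric.infDist w X + ‖r‖ := by
    have h1 : ‖w + r - z‖ ≤ Metric.infDist (w + r) X :=
      (Metric.le_infDist ⟨y, hyX⟩).2 fun v hv => by
        rw [dist_eq_norm]; exact hz.2 v hv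
    refine h1.trans ((Metric.infDist_le_infDist_add_dist (y := w)).trans_eq ?_)
    rw [dist_eq_norm, add_sub_cancel_left]
  -- The error r enters twice: it shifts the projected point and it lengthens the distance to X.
  have hzw : ‖z - w‖ ≤ (4 * Lρ * M ^ 2 / σ ^ 2 + 2 * Mξ) * a ^ 2 := by
    have h1 : z - w = r - (w + r - z) := by abel
    calc ‖z - w‖ ≤ ‖r‖ + ‖w + r - z‖ := by rw [h1]; exact norm_sub_le _ _
      _ ≤ Mξ * a ^ 2 + (Lρ * (2 * M / σ * a) ^ 2 + Mξ * a ^ 2) := by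
        linarith
      _ = _ := by ring
  have hzy : ‖z - y‖ ≤ 4 * MQ * M / σ * a := by
    have h1 : ‖z - w‖ ≤ 2 * MQ * M / σ * a := by
      -- One factor a is traded for Mδ, so the quadratic correction is no longer than the bound on
      -- the Newton step.
      have h2 : (4 * Lρ * M ^ 2 / σ ^ 2 + 2 * Mξ) * (M * δ) ≤ 2 * MQ * M / σ := by
        have e1 : (4 * Lρ * M ^ 2 / σ ^ 2 + 2 * Mξ) * (M * δ)
            = (4 * Lρ * M ^ 2 + 2 * Mξ * σ ^ 2) * δ * M / σ ^ 2 := by field_simp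
        have e2 : 2 * MQ * M / σ = (2 * (MQ * σ)) * M / σ ^ 2 := by field_simp
        rw [e1, e2]
        refine div_le_div_of_nonneg_right (mul_le_mul_of_nonneg_right ?_ hM.le) (sq_nonneg σ)
        have h3 : 0 ≤ δ * (Lρ * M ^ 2) := by have := B.δ_pos; positivity
        linarith [B.δ_mul_error]
      calc ‖z - w‖ ≤ (4 * Lρ * M ^ 2 / σ ^ 2 + 2 * Mξ) * a * a := by
            rw [mul_assoc, ← sq]; exact hzw
        _ ≤ (4 * Lρ * M ^ 2 / σ ^ 2 + 2 * Mξ) * (M * δ) * a := by gcongr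
        _ ≤ _ := by gcongr
    have h2 : z - y = (z - w) + (w - y) := by abel
    calc ‖z - y‖ ≤ ‖z - w‖ + ‖w - y‖ := by rw [h2]; exact norm_add_le _ _
      _ ≤ 2 * MQ * M / σ * a + 2 * MQ * M / σ * a := by
        rw [hwy, norm_neg]; exact add_le_add h1 hQd
      _ = _ := by ring
  refine ⟨hzy, ?_⟩
  -- both points stay in the ball on which the bounds hold
  have hball : ∀ v, ‖v - y‖ ≤ 4 * MQ * M / σ * a → v ∈ Metric.closedBall x γ := fun v hv => by
    rw [mem_closedBall_iff_norm]
    calc ‖v - x‖ ≤ ‖v - y‖ + ‖y - x‖ := norm_sub_le_norm_sub_add_norm_sub _ _ _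
      _ ≤ 4 * MQ * M / σ * (M * δ) + δ :=
        add_le_add (hv.trans (by gcongr)) hyδ
      _ = δ * (σ + 4 * MQ * M ^ 2) / σ := by field_simp; ring
      _ ≤ γ := by rw [div_le_iff₀ hσ]; exact B.δ_mul_radius
  have hwγ : w ∈ Metric.closedBall x γ := hball w (by
    rw [hwy, norm_neg]
    refine hQd.trans ?_
    gcongr
    norm_num)
  have hcw : ‖c w‖ ≤ 2 * Lτ / σ * a ^ 2 + 2 * L * MQ ^ 2 * M ^ 2 / σ ^ 2 * a ^ 2 := by
    have h1 := norm_sub_sub_fderiv_le (convex_closedBall x γ) hX.differentiable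
      B.grad_lipschitz hyγ hwγ
    -- The Newton equation (G + tI)h = c(y): only the regularization survives in the linearized
    -- residual.
    have h2 : c y + fderiv ℝ c y (w - y) = t • h := by
      have h3 : gramMap c Q y h + t • h = c y := hGh
      rw [hwy, map_neg, hdh, ← gramMap_apply, ← h3]
      abel
    have h4 : c w = (c w - c y - fderiv ℝ c y (w - y)) + t • h := by rw [← h2]; abel
    calc ‖c w‖ ≤ ‖c w - c y - fderiv ℝ c y (w - y)‖ + ‖t • h‖ := by
          rw [h4]; exact (norm_add_le _ _).trans_eq (by rw [← h4])
      _ ≤ L / 2 * (2 * MQ * M / σ * a) ^ 2 + (Lτ * a) * (2 / σ * a) := by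
        refine add_le_add (h1.trans ?_) ?_
        · rw [hwy, norm_neg]
          gcongr
        · rw [norm_smul, Real.norm_of_nonneg ht0]
          gcongr
          exact ht0.trans hta
      _ = _ := by ring
  have hcz : ‖c z - c w‖ ≤ M * ((4 * Lρ * M ^ 2 / σ ^ 2 + 2 * Mξ) * a ^ 2) :=
    (norm_sub_le_of_gradMap_le (convex_closedBall x γ) hX.differentiable B.grad_le hwγ
      (hball z hzy)).trans (by gcongr)
  calc ‖c z‖ ≤ ‖c w‖ + ‖c z - c w‖ := norm_le_norm_add_norm_sub' _ _
    _ ≤ (2 * Lτ / σ * a ^ 2 + 2 * L * MQ ^ 2 * M ^ 2 / σ ^ 2 * a ^ 2)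
        + M * ((4 * Lρ * M ^ 2 / σ ^ 2 + 2 * Mξ) * a ^ 2) := add_le_add hcw hcz
    _ = (4 * Lρ * M ^ 3 + 2 * Lτ * σ + 2 * L * MQ ^ 2 * M ^ 2 + 2 * σ ^ 2 * M * Mξ) / σ ^ 2
        * a ^ 2 := by field_simp; ring
    -- The argument yields 4Lρ; the constant in the rate allows 12Lρ.
    _ ≤ _ := by
      gcongr
      norm_num

/-- Under the local bounds, the inexact scheme started close to `x` converges quadratically. -/
theorem converges (B : LocalBounds X c Q ρ ξ Lτ x γ M MQ L Lρ Mξ σ δ) (hX : SetAssumption X c)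
    (hQ : IsProjectiveMapping X Q ρ) (hτ : IsRegularization τ Lτ) (hx : x ∈ feasibleSet X c)
    {R : ℝ} (hR : R = (12 * Lρ * M ^ 3 + 2 * Lτ * σ + 2 * L * MQ ^ 2 * M ^ 2
      + 2 * σ ^ 2 * M * Mξ) / σ ^ 2)
    {u : ℕ → Vec n}
    (hu0 : u 0 ∈ X ∩ Metric.closedBall x (σ / (32 * MQ * M ^ 2 + 2 * σ) * δ))
    (hu : IsGenerated X c Q τ ξ u) :
    (∀ k, u k ∈ X ∩ Metric.closedBall x δ) ∧
    (∀ k, ‖c (u (k + 1))‖ ≤ R * ‖c (u k)‖ ^ 2) ∧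
    (∀ k, Metric.infDist (u (k + 1)) (feasibleSet X c)
      ≤ 8 * MQ * M / σ * R * M ^ 2 * Metric.infDist (u k) (feasibleSet X c) ^ 2) ∧
    ∃ xlim ∈ feasibleSet X c ∩ (X ∩ Metric.closedBall x δ),
      Tendsto u atTop (𝓝 xlim) ∧
      ∀ k, ‖u (k + 1) - xlim‖ ≤ 8 * MQ * M / σ * R * M ^ 2 * ‖u k - xlim‖ ^ 2 := by
  obtain ⟨r, hr, hproj⟩ := hu
  have hσ := B.σ_pos
  have hM := B.M_pos
  have hMQ := B.MQ_pos
  have hL := B.L_nonneg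
  have hLρ := B.Lρ_nonneg
  have hMξ := B.Mξ_nonneg
  have hδ := B.δ_pos
  have hcx : c x = 0 := hx.2
  have hτpos := hτ.const_pos
  have hR0 : 0 ≤ R := by rw [hR]; positivity
  have hRδ : R * (M * δ) ≤ 1 / 2 := by
    rw [hR, div_mul_eq_mul_div, div_le_iff₀ (by positivity)]
    linarith [B.δ_mul_rate]
  have hxγ : x ∈ Metric.closedBall x γ := Metric.mem_closedBall_self B.γ_pos.le
  have hγ : Metric.closedBall x δ ⊆ Metric.closedBall x γ :=
    Metric.closedBall_subset_closedBall B.δ_le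
  set D := 4 * MQ * M / σ with hD
  have hD0 : 0 ≤ D := by positivity
  set δ' := σ / (32 * MQ * M ^ 2 + 2 * σ) * δ with hδ'
  have hδ'0 : 0 ≤ δ' := by positivity
  -- The starting radius makes the initial value of ‖u k - x‖ + 2D‖c (u k)‖ at most δ/2.
  have hδ'2 : δ' + 2 * D * (M * δ') ≤ δ / 2 := by
    have e : δ' + 2 * D * (M * δ') = δ * (σ + 8 * MQ * M ^ 2) / (32 * MQ * M ^ 2 + 2 * σ) := by
      rw [hδ', hD]; field_simp; ring
    rw [e, div_le_iff₀ (by positivity)]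
    have : 0 ≤ δ * (MQ * M ^ 2) := by positivity
    linarith
  have hstep : ∀ k, u k ∈ X ∩ Metric.closedBall x δ →
      ‖u (k + 1) - u k‖ ≤ D * ‖c (u k)‖ ∧ ‖c (u (k + 1))‖ ≤ R * ‖c (u k)‖ ^ 2 :=
    fun k hk => by rw [hR]; exact B.step hX hQ hτ hcx hk (hr k) (hproj k)
  have hhalf : ∀ k, u k ∈ X ∩ Metric.closedBall x δ → ‖c (u (k + 1))‖ ≤ ‖c (u k)‖ / 2 :=
    fun k hk => by
      have h1 : ‖c (u k)‖ ≤ M * δ := (B.norm_le hX.differentiable (hγ hk.2) hxγ hcx).trans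
        (mul_le_mul_of_nonneg_left (mem_closedBall_iff_norm.1 hk.2) hM.le)
      calc ‖c (u (k + 1))‖ ≤ R * ‖c (u k)‖ * ‖c (u k)‖ := by
            rw [mul_assoc, ← sq]; exact (hstep k hk).2
        _ ≤ R * (M * δ) * ‖c (u k)‖ := by gcongr
        _ ≤ 1 / 2 * ‖c (u k)‖ := by gcongr
        _ = _ := by ring
  have hu0' : ‖u 0 - x‖ ≤ δ' := mem_closedBall_iff_norm.1 hu0.2
  have hδ'δ : δ' ≤ δ / 2 := by
    have : 0 ≤ 2 * D * (M * δ') := by positivity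
    linarith
  have hc0 : ‖c (u 0)‖ ≤ M * δ' :=
    (B.norm_le hX.differentiable
      (hγ (Metric.closedBall_subset_closedBall (by linarith) hu0.2)) hxγ hcx).trans
      (mul_le_mul_of_nonneg_left hu0' hM.le)
  -- the quantity `‖u k - x‖ + 2 D ‖c (u k)‖` does not increase
  have hinv : ∀ k, u k ∈ X ∧ ‖u k - x‖ + 2 * D * ‖c (u k)‖ ≤ δ / 2 := by
    intro k
    induction k with
    | zero =>
      refine ⟨hu0.1, ?_⟩
      have : 2 * D * ‖c (u 0)‖ ≤ 2 * D * (M * δ') := by gcongr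
      linarith
    | succ k ih =>
      have hk : u k ∈ X ∩ Metric.closedBall x δ := by
        refine ⟨ih.1, mem_closedBall_iff_norm.2 ?_⟩
        have : 0 ≤ 2 * D * ‖c (u k)‖ := by positivity
        linarith [ih.2]
      refine ⟨(hproj k).1, ?_⟩
      have h1 : ‖u (k + 1) - x‖ ≤ ‖u (k + 1) - u k‖ + ‖u k - x‖ :=
        norm_sub_le_norm_sub_add_norm_sub _ _ _
      have h2 := (hstep k hk).1
      -- Halving the residual releases D‖c (u k)‖, which pays for the length of the step.
      have h3 : 2 * D * ‖c (u (k + 1))‖ ≤ 2 * D * (‖c (u k)‖ / 2) := by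
        gcongr
        exact hhalf k hk
      linarith [ih.2]
  have hclose : ∀ k, ‖u k - x‖ ≤ δ / 2 := fun k => by
    have : 0 ≤ 2 * D * ‖c (u k)‖ := by positivity
    linarith [(hinv k).2]
  have hmem : ∀ k, u k ∈ X ∩ Metric.closedBall x δ := fun k =>
    ⟨(hinv k).1, mem_closedBall_iff_norm.2 (by linarith [hclose k])⟩
  have hgeom : ∀ k j, ‖c (u (k + j))‖ ≤ ‖c (u k)‖ / 2 ^ j := by
    intro k j
    induction j with
    | zero => simp
    | succ j ih =>
      calc ‖c (u (k + (j + 1)))‖ ≤ ‖c (u (k + j))‖ / 2 := hhalf (k + j) (hmem _)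
        _ ≤ ‖c (u k)‖ / 2 ^ j / 2 := by gcongr
        _ = _ := by rw [pow_succ, div_div]
  have hdist : ∀ k j, dist (u (k + j)) (u (k + (j + 1))) ≤ 2 * D * ‖c (u k)‖ / 2 / 2 ^ j := by
    intro k j
    rw [dist_comm, dist_eq_norm]
    calc ‖u (k + (j + 1)) - u (k + j)‖ ≤ D * ‖c (u (k + j))‖ := (hstep (k + j) (hmem _)).1
      _ ≤ D * (‖c (u k)‖ / 2 ^ j) := by gcongr; exact hgeom k j
      _ = _ := by ring
  have hcauchy : CauchySeq u := cauchySeq_of_le_geometric_two (C := 2 * D * ‖c (u 0)‖)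
    fun j => by simpa using hdist 0 j
  obtain ⟨xlim, hlim⟩ := cauchySeq_tendsto_of_complete hcauchy
  have hlimX : xlim ∈ X := hX.isClosed.mem_of_tendsto hlim (Eventually.of_forall fun k => (hmem k).1)
  have hlimδ : xlim ∈ Metric.closedBall x δ :=
    Metric.isClosed_closedBall.mem_of_tendsto hlim (Eventually.of_forall fun k => (hmem k).2)
  have hlimc : c xlim = 0 := by
    have h1 : Tendsto (fun k => c (u k)) atTop (𝓝 (c xlim)) :=
      (hX.differentiable.continuous.tendsto xlim).comp hlim
    have h2 : Tendsto (fun k => c (u k)) atTop (𝓝 0) := by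
      refine squeeze_zero_norm (a := fun k => ‖c (u 0)‖ * (1 / 2) ^ k) (fun k => ?_) ?_
      · simpa [div_eq_mul_inv] using hgeom 0 k
      · simpa using (tendsto_pow_atTop_nhds_zero_of_lt_one (r := (1 / 2 : ℝ)) (by norm_num)
          (by norm_num)).const_mul ‖c (u 0)‖
    exact tendsto_nhds_unique h1 h2
  have hlimK : xlim ∈ feasibleSet X c := ⟨hlimX, hlimc⟩
  -- Summing the geometric tail from k, not from 0, bounds the error by the current residual.
  have herr : ∀ k, ‖u k - xlim‖ ≤ 2 * D * ‖c (u k)‖ := fun k => by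
    rw [← dist_eq_norm]
    have h1 : Tendsto (fun j => u (k + j)) atTop (𝓝 xlim) := by
      have := (tendsto_add_atTop_iff_nat k).2 hlim
      simpa only [add_comm] using this
    exact dist_le_of_le_geometric_two_of_tendsto₀ (hdist k) h1
  have hnext : ∀ k, ‖u (k + 1) - xlim‖ ≤ 2 * D * R * ‖c (u k)‖ ^ 2 := fun k =>
    calc ‖u (k + 1) - xlim‖ ≤ 2 * D * ‖c (u (k + 1))‖ := herr (k + 1)
      _ ≤ 2 * D * (R * ‖c (u k)‖ ^ 2) := by gcongr; exact (hstep k (hmem k)).2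
      _ = _ := by ring
  have hconst : 8 * MQ * M / σ = 2 * D := by rw [hD]; ring
  -- Here b serves both for the distance to the limit and for the distance to K.
  have hquad : ∀ k, ∀ b, ‖c (u k)‖ ≤ M * b → ‖u (k + 1) - xlim‖ ≤
      8 * MQ * M / σ * R * M ^ 2 * b ^ 2 := fun k b hb => by
    rw [hconst]
    calc ‖u (k + 1) - xlim‖ ≤ 2 * D * R * ‖c (u k)‖ ^ 2 := hnext k
      _ ≤ 2 * D * R * (M * b) ^ 2 := by gcongr
      _ = _ := by ring
  refine ⟨hmem, fun k => (hstep k (hmem k)).2, fun k => ?_, xlim, ⟨hlimK, hlimX, hlimδ⟩, hlim,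
    fun k => hquad k _ (B.norm_le hX.differentiable (hγ (hmem k).2) (hγ hlimδ) hlimc)⟩
  refine ((Metric.infDist_le_dist_of_mem hlimK).trans_eq (dist_eq_norm _ _)).trans (hquad k _ ?_)
  rw [← div_le_iff₀' hM]
  refine (Metric.le_infDist ⟨x, hx⟩).2 fun v hv => ?_
  rw [div_le_iff₀' hM, dist_eq_norm]
  -- The bounds hold only near x. A feasible v no farther from u k than x satisfies ‖v - x‖ ≤ 2‖u k
  -- - x‖ ≤ δ ≤ γ; a farther v is dominated by x itself.
  rcases le_total ‖u k - v‖ ‖u k - x‖ with h | h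
  · refine B.norm_le hX.differentiable (hγ (hmem k).2) ?_ hv.2
    rw [mem_closedBall_iff_norm]
    have h1 : ‖v - x‖ ≤ ‖v - u k‖ + ‖u k - x‖ := norm_sub_le_norm_sub_add_norm_sub _ _ _
    rw [norm_sub_rev v (u k)] at h1
    linarith [hclose k, B.δ_le]
  · exact (B.norm_le hX.differentiable (hγ (hmem k).2) hxγ hcx).trans
      (mul_le_mul_of_nonneg_left h hM.le)

end LocalBounds

/-! ### Quotients with value +∞ at zero denominator. -/

section QuotTop

theorem quotTop_pos {a b : ℝ} (ha : 0 < a) (hb : 0 ≤ b) : 0 < quotTop a b := by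
  unfold quotTop
  split_ifs with h
  · exact EReal.coe_lt_top 0
  · exact EReal.coe_pos.2 (div_pos ha (lt_of_le_of_ne hb (Ne.symm h)))

/-- Clearing the denominator removes the case split: for b = 0 the conclusion is just 0 ≤ a. -/
theorem mul_le_of_le_quotTop {a b d : ℝ} (ha : 0 ≤ a) (hb : 0 ≤ b)
    (h : (d : EReal) ≤ quotTop a b) : d * b ≤ a := by
  unfold quotTop at h
  split_ifs at h with h0
  · rw [h0, mul_zero]; exact ha
  · exact (le_div_iff₀ (lt_of_le_of_ne hb (Ne.symm h0))).1 (EReal.coe_le_coe_iff.1 h)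

end QuotTop

/-! ### The concrete constants satisfy the abstract bounds. -/

section Constants

variable {n p : ℕ} {X : Set (Vec n)} {c : Vec n → Vec p} {Q : Vec n → Vec n →L[ℝ] Vec n}
  {ρ ξ : Vec n → ℝ} {τ : ℝ≥0 → ℝ≥0} {Lτ : ℝ} {x : Vec n}

theorem sigmaQ_pos (hp : 1 ≤ p) (hQ : IsProjectiveMapping X Q ρ) (hx : x ∈ X)
    (hnd : Nondegenerate X c x) : 0 < sigmaQ c Q x :=
  sigmaMin_pos hp _ fun _ => eq_zero_of_gramMap_eq_zero hQ hx hnd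

theorem sigmaC_pos (hp : 1 ≤ p) (hQ : IsProjectiveMapping X Q ρ) (hx : x ∈ X)
    (hnd : Nondegenerate X c x) : 0 < sigmaC c x :=
  sigmaMin_pos hp _ fun v hv => eq_zero_of_gramMap_eq_zero hQ hx hnd (by
    rw [gramMap_apply, hv, map_zero, map_zero])

theorem bddAbove_gammaR :
    BddAbove {γ : ℝ | 0 < γ ∧ γ ≤ 1 ∧
      ∀ y ∈ X ∩ Metric.closedBall x γ, sigmaQ c Q x / 2 ≤ sigmaMin (gramMap c Q y)} :=
  ⟨1, fun _ h => h.2.1⟩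

/-- A perturbation of norm at most σ/2 lowers the smallest singular value by at most σ/2. -/
theorem gammaR_set_nonempty (hp : 1 ≤ p) (hcont : ContinuousOn (gramMap c Q) X) (hx : x ∈ X)
    (hσ : 0 < sigmaQ c Q x) :
    {γ : ℝ | 0 < γ ∧ γ ≤ 1 ∧
      ∀ y ∈ X ∩ Metric.closedBall x γ, sigmaQ c Q x / 2 ≤ sigmaMin (gramMap c Q y)}.Nonempty := by
  obtain ⟨r, hr, hball⟩ := Metric.continuousOn_iff.1 hcont x hx (sigmaQ c Q x / 2) (by positivity)
  refine ⟨min 1 (r / 2), lt_min one_pos (by positivity), min_le_left _ _, fun y hy => ?_⟩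
  refine le_sigmaMin hp _ fun v => ?_
  have h1 := hball y hy.1 ((Metric.mem_closedBall.1 hy.2).trans_lt
    ((min_le_right _ _).trans_lt (by linarith)))
  rw [dist_comm, dist_eq_norm] at h1
  have h2 := sigmaMin_mul_norm_le hp (gramMap c Q x) v
  have h3 : ‖gramMap c Q x v - gramMap c Q y v‖ ≤ sigmaQ c Q x / 2 * ‖v‖ := by
    rw [← _root_.sub_apply]
    exact (le_opNorm _ _).trans (mul_le_mul_of_nonneg_right h1.le (norm_nonneg _))
  have h4 : ‖gramMap c Q x v‖ ≤ ‖gramMap c Q y v‖ + ‖gramMap c Q x v - gramMap c Q y v‖ :=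
    norm_le_norm_add_norm_sub' _ _
  change sigmaQ c Q x * ‖v‖ ≤ _ at h2
  linarith

theorem gammaR_pos (hp : 1 ≤ p) (hcont : ContinuousOn (gramMap c Q) X) (hx : x ∈ X)
    (hσ : 0 < sigmaQ c Q x) : 0 < gammaR X c Q x := by
  obtain ⟨γ, hγ⟩ := gammaR_set_nonempty hp hcont hx hσ
  exact hγ.1.trans_le (le_csSup bddAbove_gammaR hγ)

/-- Strict inequality is needed: the supremum need not be attained, since X may have a bad point on
the bounding sphere. -/
theorem half_sigmaQ_le_of_lt_gammaR (hp : 1 ≤ p) (hcont : ContinuousOn (gramMap c Q) X)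
    (hx : x ∈ X) (hσ : 0 < sigmaQ c Q x) {y : Vec n} (hy : y ∈ X)
    (hlt : dist y x < gammaR X c Q x) : sigmaQ c Q x / 2 ≤ sigmaMin (gramMap c Q y) := by
  obtain ⟨γ, hγ, hyγ⟩ := exists_lt_of_lt_csSup (gammaR_set_nonempty hp hcont hx hσ) hlt
  exact hγ.2.2 y ⟨hy, hyγ.le⟩

theorem norm_gradMap_le_constMc (hX : SetAssumption X c) {y : Vec n}
    (hy : y ∈ Metric.closedBall x (gammaR X c Q x)) : ‖gradMap c y‖ ≤ constMc X c Q x :=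
  le_csSup ((isCompact_closedBall _ _).bddAbove_image
    hX.gradLocallyLipschitz.continuous.norm.continuousOn) (mem_image_of_mem _ hy)

theorem norm_le_constMQ (hX : SetAssumption X c) (hQ : IsProjectiveMapping X Q ρ) {y : Vec n}
    (hy : y ∈ X ∩ Metric.closedBall x (gammaR X c Q x)) : ‖Q y‖ ≤ constMQ X c Q x :=
  le_csSup (((isCompact_closedBall _ _).inter_left hX.isClosed).bddAbove_image
    (hQ.continuousOn.norm.mono inter_subset_left)) (mem_image_of_mem _ hy)

theorem le_constMxi (hξ : IsInexactness ξ) {y : Vec n}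
    (hy : y ∈ Metric.closedBall x (gammaR X c Q x)) : ξ y ≤ constMxi X c Q ξ x :=
  le_csSup (hξ.locallyBounded _ (isCompact_closedBall _ _)) (mem_image_of_mem _ hy)

theorem le_constLrho (hX : SetAssumption X c) (hQ : IsProjectiveMapping X Q ρ) {y : Vec n}
    (hy : y ∈ X ∩ Metric.closedBall x (gammaR X c Q x)) : ρ y ≤ constLrho X c Q ρ x :=
  le_csSup (hQ.rho_locallyBounded _ inter_subset_left
    ((isCompact_closedBall _ _).inter_left hX.isClosed)) (mem_image_of_mem _ hy)

theorem constLc_nonneg : 0 ≤ constLc X c Q x := by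
  refine Real.sSup_nonneg ?_
  rintro l ⟨y, _, z, _, _, rfl⟩
  positivity

theorem norm_gradMap_sub_le_constLc (hX : SetAssumption X c) {y z : Vec n}
    (hy : y ∈ Metric.closedBall x (gammaR X c Q x))
    (hz : z ∈ Metric.closedBall x (gammaR X c Q x)) :
    ‖gradMap c y - gradMap c z‖ ≤ constLc X c Q x * ‖y - z‖ := by
  rcases eq_or_ne y z with rfl | hne
  · simp
  -- Compactness gives one Lipschitz constant on the ball, so the supremum is over a bounded set.
  obtain ⟨K, hK⟩ := hX.gradLocallyLipschitz.locallyLipschitzOn.exists_lipschitzOnWith_of_compact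
    (isCompact_closedBall x (gammaR X c Q x))
  have hpos : ∀ {a b : Vec n}, a ≠ b → 0 < ‖a - b‖ := fun h => norm_pos_iff.2 (sub_ne_zero.2 h)
  rw [← div_le_iff₀ (hpos hne)]
  refine le_csSup ⟨K, ?_⟩ ⟨y, hy, z, hz, hne, rfl⟩
  rintro l ⟨a, ha, b, hb, hab, rfl⟩
  rw [div_le_iff₀ (hpos hab), ← dist_eq_norm, ← dist_eq_norm]
  exact hK.dist_le_mul a ha b hb

/-- The constants attached to a nondegenerate point satisfy the local bounds. -/
theorem localBounds (hp : 1 ≤ p) (hX : SetAssumption X c) (hQ : IsProjectiveMapping X Q ρ)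
    (hτ : IsRegularization τ Lτ) (hξ : IsInexactness ξ) (hx : x ∈ X)
    (hnd : Nondegenerate X c x) :
    LocalBounds X c Q ρ ξ Lτ x (gammaR X c Q x) (constMc X c Q x) (constMQ X c Q x)
      (constLc X c Q x) (constLrho X c Q ρ x) (constMxi X c Q ξ x) (sigmaQ c Q x)
      (deltaR X c Q ρ ξ Lτ x) := by
  have hcont := gramMap_continuousOn hX.gradLocallyLipschitz.continuous hQ.continuousOn
  have hσ := sigmaQ_pos hp hQ hx hnd
  have hσc := sigmaC_pos hp hQ hx hnd
  have hγ := gammaR_pos hp hcont hx hσ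
  have hxb : x ∈ Metric.closedBall x (gammaR X c Q x) := Metric.mem_closedBall_self hγ.le
  have hgx := norm_gradMap_le_constMc (Q := Q) hX hxb
  have hQx := norm_le_constMQ hX hQ ⟨hx, hxb⟩
  have hMc0 := (norm_nonneg _).trans hgx
  have hMQ0 := (norm_nonneg _).trans hQx
  have hLρ : 0 ≤ constLrho X c Q ρ x := (hQ.rho_nonneg x hx).trans (le_constLrho hX hQ ⟨hx, hxb⟩)
  have hMξ : 0 ≤ constMxi X c Q ξ x := (hξ.nonneg x).trans (le_constMxi hξ hxb)
  have hL := constLc_nonneg (X := X) (c := c) (Q := Q) (x := x)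
  have hLτ := hτ.const_pos
  -- the smallest singular value bounds the norms of the factors from below
  have hprod : sigmaQ c Q x ≤ constMc X c Q x * (constMQ X c Q x * constMc X c Q x) := by
    set e : Vec p := EuclideanSpace.single ⟨0, hp⟩ 1
    have he : ‖e‖ = 1 := by simp [e]
    have h1 := sigmaMin_mul_norm_le hp (gramMap c Q x) e
    rw [he, mul_one] at h1
    refine h1.trans ((le_opNorm _ _).trans ?_)
    rw [he, mul_one, gramMap]
    refine (opNorm_comp_le _ _).trans ?_
    rw [LinearIsometryEquiv.norm_map]
    refine mul_le_mul hgx ((opNorm_comp_le _ _).trans ?_) (norm_nonneg _) hMc0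
    exact mul_le_mul hQx hgx (norm_nonneg _) hMQ0
  have hMc : 0 < constMc X c Q x := lt_of_le_of_ne hMc0 fun h => by
    rw [← h, zero_mul] at hprod; linarith
  have hMQ : 0 < constMQ X c Q x := lt_of_le_of_ne hMQ0 fun h => by
    rw [← h, zero_mul, mul_zero] at hprod; linarith
  have hN : 0 < rateNum X c Q ρ ξ Lτ x := by unfold rateNum; positivity
  have hmin : 0 < deltaR X c Q ρ ξ Lτ x ∧ (deltaR X c Q ρ ξ Lτ x : EReal) ≤
      (((gammaR X c Q x / 2 : ℝ) : EReal)
        ⊓ quotTop 1 (constMc X c Q x)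
        ⊓ quotTop (sigmaC c x) (6 * constLc X c Q x)
        ⊓ quotTop (sigmaQ c Q x) (2 * constMc X c Q x ^ 2)
        ⊓ quotTop (gammaR X c Q x * sigmaQ c Q x)
          (sigmaQ c Q x + 4 * constMQ X c Q x * constMc X c Q x ^ 2)
        ⊓ quotTop (constMQ X c Q x * sigmaQ c Q x)
          (4 * constLrho X c Q ρ x * constMc X c Q x ^ 2
            + constMxi X c Q ξ x * sigmaQ c Q x ^ 2)
        ⊓ quotTop (sigmaQ c Q x ^ 2) (rateNum X c Q ρ ξ Lτ x * (2 * constMc X c Q x))) := by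
    have hpos : 0 < (((gammaR X c Q x / 2 : ℝ) : EReal)
        ⊓ quotTop 1 (constMc X c Q x)
        ⊓ quotTop (sigmaC c x) (6 * constLc X c Q x)
        ⊓ quotTop (sigmaQ c Q x) (2 * constMc X c Q x ^ 2)
        ⊓ quotTop (gammaR X c Q x * sigmaQ c Q x)
          (sigmaQ c Q x + 4 * constMQ X c Q x * constMc X c Q x ^ 2)
        ⊓ quotTop (constMQ X c Q x * sigmaQ c Q x)
          (4 * constLrho X c Q ρ x * constMc X c Q x ^ 2
            + constMxi X c Q ξ x * sigmaQ c Q x ^ 2)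
        ⊓ quotTop (sigmaQ c Q x ^ 2) (rateNum X c Q ρ ξ Lτ x * (2 * constMc X c Q x))) := by
      simp only [lt_inf_iff]
      refine ⟨⟨⟨⟨⟨⟨EReal.coe_pos.2 (by positivity), ?_⟩, ?_⟩, ?_⟩, ?_⟩, ?_⟩, ?_⟩ <;>
        exact quotTop_pos (by positivity) (by positivity)
    have htop : deltaR X c Q ρ ξ Lτ x = EReal.toReal _ := rfl
    rw [htop]
    -- The finite entry γ/2 excludes ⊤ and positivity excludes ⊥, so `toReal` loses nothing.
    refine ⟨EReal.toReal_pos hpos (ne_top_of_le_ne_top (EReal.coe_ne_top (gammaR X c Q x / 2)) ?_),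
      EReal.coe_toReal_le (ne_bot_of_gt hpos)⟩
    iterate 5 refine inf_le_left.trans ?_
    exact inf_le_left
  obtain ⟨hδ, hle⟩ := hmin
  simp only [le_inf_iff] at hle
  obtain ⟨⟨⟨⟨⟨⟨h1, h2⟩, -⟩, h3⟩, h4⟩, h5⟩, h6⟩ := hle
  have h1 := EReal.coe_le_coe_iff.1 h1
  exact
    { σ_pos := hσ
      M_pos := hMc
      MQ_pos := hMQ
      L_nonneg := hL
      Lρ_nonneg := hLρ
      Mξ_nonneg := hMξ
      δ_pos := hδ
      grad_le := fun y hy => norm_gradMap_le_constMc hX hy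
      grad_lipschitz := fun y hy z hz => norm_gradMap_sub_le_constLc hX hy hz
      Q_le := fun y hy => norm_le_constMQ hX hQ hy
      ρ_le := fun y hy => le_constLrho hX hQ hy
      ξ_le := fun y hy => le_constMxi hξ hy
      gram_ge := fun y hy v =>
        (mul_le_mul_of_nonneg_right (half_sigmaQ_le_of_lt_gammaR hp hcont hx hσ hy.1
          ((Metric.mem_closedBall.1 hy.2).trans_lt (by linarith))) (norm_nonneg v)).trans
          (sigmaMin_mul_norm_le hp _ v)
      δ_le_half := h1
      δ_mul_M := mul_le_of_le_quotTop (by positivity) (by positivity) h2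
      δ_mul_sq := mul_le_of_le_quotTop (by positivity) (by positivity) h3
      δ_mul_radius := mul_le_of_le_quotTop (by positivity) (by positivity) h4
      δ_mul_error := mul_le_of_le_quotTop (by positivity) (by positivity) h5
      δ_mul_rate := mul_le_of_le_quotTop (by positivity) (by positivity) h6 }

end Constants

/-! ### The theorem. -/

theorem mainTheorem1 {n p : ℕ} (hp : 1 ≤ p)
    (X : Set (Vec n)) (c : Vec n → Vec p) (Q : Vec n → Vec n →L[ℝ] Vec n)
    (ρ ξ : Vec n → ℝ) (τ : ℝ≥0 → ℝ≥0) (Lτ : ℝ)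
    (hX : SetAssumption X c) (hQ : IsProjectiveMapping X Q ρ)
    (hτ : IsRegularization τ Lτ) (hξ : IsInexactness ξ)
    (x : Vec n) (hx : x ∈ feasibleSet X c) (hnd : Nondegenerate X c x) :
    -- `Ξ_x` is a genuine neighbourhood of `x` in `X`
    0 < deltaR' X c Q ρ ξ Lτ x ∧
    ∃ C : ℝ, 0 < C ∧
      ∀ u : ℕ → Vec n, u 0 ∈ xiSet X c Q ρ ξ Lτ x → IsGenerated X c Q τ ξ u →
        (∀ k, u k ∈ omegaSet X c Q ρ ξ Lτ x) ∧
        (∀ k, ‖c (u (k + 1))‖ ≤ rateConst X c Q ρ ξ Lτ x * ‖c (u k)‖ ^ 2) ∧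
        (∀ k, Metric.infDist (u (k + 1)) (feasibleSet X c)
          ≤ C * Metric.infDist (u k) (feasibleSet X c) ^ 2) ∧
        ∃ xlim ∈ feasibleSet X c ∩ omegaSet X c Q ρ ξ Lτ x,
          Tendsto u atTop (𝓝 xlim) ∧
          ∀ k, ‖u (k + 1) - xlim‖ ≤ C * ‖u k - xlim‖ ^ 2 := by
  have B := localBounds (ρ := ρ) (ξ := ξ) (τ := τ) (Lτ := Lτ) hp hX hQ hτ hξ hx.1 hnd
  have hσ := B.σ_pos
  have hM := B.M_pos
  have hMQ := B.MQ_pos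
  have hδ := B.δ_pos
  set R := rateConst X c Q ρ ξ Lτ x
  set C := 8 * constMQ X c Q x * constMc X c Q x / sigmaQ c Q x * R * constMc X c Q x ^ 2
  -- |C| + 1 is positive and dominates C without a separate sign argument for C.
  refine ⟨by unfold deltaR'; positivity, |C| + 1, by positivity, fun u hu0 hu => ?_⟩
  have hC : ∀ a : ℝ, C * a ^ 2 ≤ (|C| + 1) * a ^ 2 := fun a =>
    mul_le_mul_of_nonneg_right (by linarith [le_abs_self C]) (sq_nonneg a)
  obtain ⟨h1, h2, h3, xlim, hxlim, hlim, h4⟩ := B.converges hX hQ hτ hx (R := R) rfl hu0 hu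
  exact ⟨h1, h2, fun k => (h3 k).trans (hC _), xlim, hxlim, hlim, fun k => (h4 k).trans (hC _)⟩
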